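/- All graphs are finite and simple. A graph is called unicyclic if it is connected and has exactly one cycle, equivalently, if it is connected and has as many edges as vertices. For a graph $G$ on $n$ vertices whose adjacency matrix has eigenvalues $\lambda_1,\dots,\lambda_n$ (counted with multiplicity), the resolvent energy of $G$ is $$ER(G)=\sum_{i=1}^{n}\frac{1}{n-\lambda_i}.$$ Theorem. Let $n\ge 5$ and let $C_n$ be the cycle on $n$ vertices. Then $C_n$ is unicyclic, and every unicyclic graph $G$ on $n$ vertices with $G\not\cong C_n$ satisfies $$ER(G)>ER(C_n).$$ In other words, up to isomorphism, $C_n$ is the unique unicyclic graph on $n$ vertices with minimum resolvent energy. -/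

import Mathlib

/-- A finite simple graph is unicyclic if it is connected and has as many edges as vertices
(that is, it is connected with cyclomatic number one). -/
def SimpleGraph.IsUnicyclic {V : Type*} [Fintype V] (G : SimpleGraph V)
    [Fintype G.edgeSet] : Prop :=
  G.Connected ∧ G.edgeFinset.card = Fintype.card V

/-- The resolvent energy `∑ i, 1 / (n - λ i)` of a graph on `n` vertices, where the `λ i` are the
eigenvalues, with multiplicity, of its real adjacency matrix. Every `λ i` is at most `n - 1`,
so no denominator vanishes. -/
noncomputable def SimpleGraph.resolventEnergy {V : Type*} [Fintype V] [DecidableEq V]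
    (G : SimpleGraph V) [DecidableRel G.Adj] : ℝ :=
  ∑ i : V, 1 / ((Fintype.card V : ℝ) -
    Matrix.IsHermitian.eigenvalues (A := G.adjMatrix ℝ) (G.isHermitian_adjMatrix ℝ) i)

open Finset Matrix

namespace Matrix.IsHermitian

variable {V : Type*} [Fintype V] [DecidableEq V] {A : Matrix V V ℝ}

/-! Both energies are compared through spectral moments, i.e. traces of powers of the adjacency
matrix. A unicyclic graph with a vertex of degree other than 2 has fourth moment at least 6n + 4,
against 6n for the cycle; a truncated Neumann series turns this into a lower bound
(`IsUnicyclic.resolventEnergy_ge`). For the cycle, a quartic majorant of 1/(n - x) on x ≤ 2 gives an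
upper bound from moments up to 4 (`resolventEnergy_cycleGraph_le`). The two rational functions of n
are separated by `resolvent_bounds_lt`. -/

theorem sum_eigenvalues_pow (hA : A.IsHermitian) (k : ℕ) :
    ∑ i, hA.eigenvalues i ^ k = (A ^ k).trace := by
  conv_rhs => rw [hA.spectral_theorem, ← map_pow, Unitary.conjStarAlgAut_apply, trace_mul_comm,
    ← mul_assoc, Unitary.coe_star_mul_self, one_mul, diagonal_pow, trace_diagonal]
  simp

end Matrix.IsHermitian

namespace SimpleGraph

/-! ### Spectral moments and the lower bound for non-cycles -/

variable {V : Type*} [Fintype V] [DecidableEq V] (G : SimpleGraph V) [DecidableRel G.Adj]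

/-- Gershgorin: every disc is centred at 0, with radius a vertex degree. -/
theorem eigenvalues_adjMatrix_le {d : ℕ} (hd : ∀ v, G.degree v ≤ d) (i : V) :
    (G.isHermitian_adjMatrix ℝ).eigenvalues i ≤ d := by
  have hA := G.isHermitian_adjMatrix ℝ
  have hmem : Module.End.HasEigenvalue (toLin' (G.adjMatrix ℝ)) (hA.eigenvalues i) := by
    rw [Module.End.hasEigenvalue_iff_mem_spectrum, spectrum_toLin']
    exact hA.eigenvalues_mem_spectrum_real i
  obtain ⟨v, hv⟩ := eigenvalue_mem_ball hmem
  have hsum : ∑ w ∈ univ.erase v, ‖G.adjMatrix ℝ v w‖ ≤ (G.degree v : ℝ) := by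
    calc ∑ w ∈ univ.erase v, ‖G.adjMatrix ℝ v w‖
        ≤ ∑ w, ‖G.adjMatrix ℝ v w‖ :=
          sum_le_sum_of_subset_of_nonneg (erase_subset _ _) fun _ _ _ => norm_nonneg _
      _ = ∑ w, if G.Adj v w then (1 : ℝ) else 0 := by
          refine sum_congr rfl fun w _ => ?_
          rw [adjMatrix_apply]
          split_ifs <;> simp
      _ = G.degree v := by
          rw [sum_boole, ← card_neighborFinset_eq_degree, neighborFinset_eq_filter]
  have hle := (le_abs_self _).trans (Metric.mem_closedBall.1 hv)
  simp only [adjMatrix_apply, G.irrefl, if_false, sub_zero] at hle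
  have hdv : (G.degree v : ℝ) ≤ d := by exact_mod_cast hd v
  exact (hle.trans (by simpa [adjMatrix_apply] using hsum)).trans hdv

theorem eigenvalues_adjMatrix_lt_card (i : V) :
    (G.isHermitian_adjMatrix ℝ).eigenvalues i < Fintype.card V := by
  have h := G.eigenvalues_adjMatrix_le (d := Fintype.card V - 1)
    (fun v => Nat.le_sub_one_of_lt (G.degree_lt_card_verts v)) i
  have hpos : 1 ≤ Fintype.card V := Fintype.card_pos_iff.2 ⟨i⟩
  rw [Nat.cast_sub hpos] at h
  push_cast at h
  linarith

theorem trace_adjMatrix_pow_nonneg (k : ℕ) : 0 ≤ (G.adjMatrix ℝ ^ k).trace := by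
  refine sum_nonneg fun i _ => ?_
  rw [diag_apply, adjMatrix_pow_apply_eq_card_walk]
  positivity

theorem trace_adjMatrix_sq : (G.adjMatrix ℝ ^ 2).trace = 2 * #G.edgeFinset := by
  have h := G.sum_degrees_eq_twice_card_edges
  rw [pow_two, trace]
  simp only [diag_apply, adjMatrix_mul_self_apply_self]
  exact_mod_cast h

theorem sum_adjMatrix_sq_apply (i : V) :
    ∑ j, (G.adjMatrix ℝ ^ 2) i j = ∑ k, G.adjMatrix ℝ i k * G.degree k := by
  simp only [pow_two, mul_apply]
  rw [sum_comm]
  refine sum_congr rfl fun k _ => ?_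
  rw [← mul_sum]
  congr 1
  simp [adjMatrix_apply, sum_boole, ← card_neighborFinset_eq_degree, neighborFinset_eq_filter]

theorem sum_sum_adjMatrix_sq :
    ∑ i, ∑ j, (G.adjMatrix ℝ ^ 2) i j = ∑ v, (G.degree v : ℝ) ^ 2 := by
  simp only [sum_adjMatrix_sq_apply]
  rw [sum_comm]
  refine sum_congr rfl fun k _ => ?_
  rw [← sum_mul, pow_two]
  congr 1
  simp [adjMatrix_apply, sum_boole, ← card_neighborFinset_eq_degree, neighborFinset_eq_filter,
    G.adj_comm]

/-- Closed walks of length four that backtrack. -/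
theorem le_trace_adjMatrix_pow_four :
    2 * ∑ v, (G.degree v : ℝ) ^ 2 - 2 * #G.edgeFinset ≤ (G.adjMatrix ℝ ^ 4).trace := by
  set B := G.adjMatrix ℝ ^ 2 with hB
  have hsymm : ∀ i j, B j i = B i j := fun i j => by
    have : Bᵀ = B := by rw [hB, transpose_pow, transpose_adjMatrix]
    exact congrFun (congrFun this i) j
  have htr : (G.adjMatrix ℝ ^ 4).trace = ∑ i, ∑ j, B i j ^ 2 := by
    rw [show 4 = 2 + 2 from rfl, pow_add, ← hB, trace]
    simp only [diag_apply, mul_apply, hsymm, pow_two]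
  have hdiag : ∀ i, B i i = G.degree i := fun i => by
    rw [hB, pow_two, adjMatrix_mul_self_apply_self]
  -- Entries count walks, so they are natural numbers.
  have hent : ∀ i j, B i j ≤ B i j ^ 2 := fun i j => by
    rw [hB, adjMatrix_pow_apply_eq_card_walk]
    exact_mod_cast Nat.le_self_pow two_ne_zero _
  have hrow : ∀ i, (∑ j, B i j) + (G.degree i ^ 2 - G.degree i : ℝ) ≤ ∑ j, B i j ^ 2 := by
    intro i
    rw [← add_sum_erase univ _ (mem_univ i), ← add_sum_erase univ (fun j => B i j ^ 2) (mem_univ i),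
      hdiag]
    linarith [sum_le_sum fun j (_ : j ∈ univ.erase i) => hent i j]
  have htot := sum_le_sum fun i (_ : i ∈ (univ : Finset V)) => hrow i
  rw [sum_add_distrib, sum_sub_distrib, G.sum_sum_adjMatrix_sq, ← htr] at htot
  have hdeg : ∑ v, (G.degree v : ℝ) = 2 * #G.edgeFinset := by
    exact_mod_cast G.sum_degrees_eq_twice_card_edges
  linarith

/-- The integers deg v - 2 sum to zero, so if one is nonzero then so is another, and their squares
sum to at least 2. -/
theorem IsUnicyclic.sum_degree_sq_ge (hG : G.IsUnicyclic) (hdeg : ∃ v, G.degree v ≠ 2) :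
    4 * (Fintype.card V : ℝ) + 2 ≤ ∑ v, (G.degree v : ℝ) ^ 2 := by
  have hsum : ∑ v, ((G.degree v : ℤ) - 2) = 0 := by
    have h := G.sum_degrees_eq_twice_card_edges
    rw [hG.2] at h
    rw [sum_sub_distrib]
    simp only [sum_const, card_univ, nsmul_eq_mul]
    have : ∑ v, (G.degree v : ℤ) = 2 * Fintype.card V := by exact_mod_cast h
    linarith
  have hsq : (2 : ℤ) ≤ ∑ v, ((G.degree v : ℤ) - 2) ^ 2 := by
    obtain ⟨v, hv⟩ := hdeg
    have hv' : (G.degree v : ℤ) - 2 ≠ 0 := by omega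
    rw [← add_sum_erase univ _ (mem_univ v)] at hsum ⊢
    have hex : ∃ w ∈ univ.erase v, (G.degree w : ℤ) - 2 ≠ 0 := by
      by_contra! h
      rw [sum_eq_zero h] at hsum
      omega
    obtain ⟨w, hw, hw'⟩ := hex
    have h1 := single_le_sum (f := fun w => ((G.degree w : ℤ) - 2) ^ 2)
      (fun _ _ => sq_nonneg _) hw
    have h2 := (sq_pos_iff (a := (G.degree w : ℤ) - 2)).2 hw'
    have h3 := (sq_pos_iff (a := (G.degree v : ℤ) - 2)).2 hv'
    omega
  have hexp : ∑ v, ((G.degree v : ℤ) - 2) ^ 2 =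
      ∑ v, (G.degree v : ℤ) ^ 2 - 4 * ∑ v, ((G.degree v : ℤ) - 2) - 4 * Fintype.card V := by
    rw [mul_sum, ← sum_sub_distrib, eq_sub_iff_add_eq]
    have : 4 * (Fintype.card V : ℤ) = ∑ v : V, 4 := by simp [mul_comm]
    rw [this, ← sum_add_distrib]
    exact sum_congr rfl fun _ _ => by ring
  rw [hexp, hsum] at hsq
  have : 4 * (Fintype.card V : ℤ) + 2 ≤ ∑ v, (G.degree v : ℤ) ^ 2 := by linarith
  exact_mod_cast this

/-- A cycle through v exhausts its component, hence is Hamiltonian and yields a bijective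
homomorphism from `cycleGraph n`; since both graphs are 2-regular, it also reflects adjacency. -/
theorem Connected.nonempty_iso_cycleGraph {n : ℕ} (hn : 3 ≤ n) (hcard : Fintype.card V = n)
    (hconn : G.Connected) (hreg : ∀ v, G.degree v = 2) : Nonempty (G ≃g cycleGraph n) := by
  obtain ⟨v⟩ := hconn.nonempty
  have hcyc : G.IsCycles := fun w _ => by
    rw [Set.ncard_eq_toFinset_card', ← hreg w]
    rfl
  have hne : (G.neighborSet v).Nonempty := by
    have : 0 < G.degree v := by rw [hreg]; norm_num
    exact (G.degree_pos_iff_exists_adj v).1 this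
  obtain ⟨p, hp, hverts⟩ := hcyc.exists_cycle_toSubgraph_verts_eq_connectedComponentSupp
    (c := G.connectedComponentMk v) rfl hne
  have hsupp : ∀ w, w ∈ p.support := fun w => by
    rw [← Walk.mem_verts_toSubgraph, hverts]
    exact ConnectedComponent.sound (hconn.preconnected w v)
  have htail : p.tail.IsHamiltonian := by
    refine hp.isPath_tail.isHamiltonian_of_mem fun w => ?_
    rw [Walk.support_tail_of_not_nil _ hp.not_nil]
    have := hsupp w
    rw [Walk.mem_support_iff] at this
    rcases this with rfl | h
    · exact Walk.end_mem_tail_support hp.not_nil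
    · exact h
  have hham : p.IsHamiltonianCycle := ⟨hp, htail⟩
  obtain ⟨f⟩ := (cycleGraph_isContained_iff (G := G) hn).2 ⟨v, p, hp, hham.length_eq.trans hcard⟩
  have hbij : Function.Bijective f :=
    (Fintype.bijective_iff_injective_and_card _).2 ⟨f.injective, by simp [hcard]⟩
  refine ⟨(RelIso.mk (Equiv.ofBijective f hbij) ?_ : cycleGraph n ≃g G).symm⟩
  intro a b
  refine ⟨fun hab => ?_, fun hab => f.toHom.map_adj hab⟩
  have hsub : ((cycleGraph n).neighborFinset a).map ⟨f, f.injective⟩ ⊆ G.neighborFinset (f a) := by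
    intro w hw
    obtain ⟨c, hc, rfl⟩ := mem_map.1 hw
    exact (mem_neighborFinset _ _ _).2 (f.toHom.map_adj ((mem_neighborFinset _ _ _).1 hc))
  have hdeg : (cycleGraph n).degree a = 2 := by
    obtain ⟨m, rfl⟩ : ∃ m, n = m + 3 := ⟨n - 3, by omega⟩
    exact cycleGraph_degree_three_le
  have heq := eq_of_subset_of_card_le hsub (by
    rw [card_map, card_neighborFinset_eq_degree, card_neighborFinset_eq_degree, hreg, hdeg])
  have hb : f b ∈ G.neighborFinset (f a) := (mem_neighborFinset _ _ _).2 hab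
  rw [← heq, mem_map] at hb
  obtain ⟨c, hc, hcb⟩ := hb
  rw [← f.injective hcb]
  exact (mem_neighborFinset _ _ _).1 hc

/-- The truncated Neumann series of the resolvent, bounded through its first moments. -/
theorem IsUnicyclic.resolventEnergy_ge (hG : G.IsUnicyclic) (hdeg : ∃ v, G.degree v ≠ 2) {n : ℕ}
    (hcard : Fintype.card V = n) :
    1 + 2 / (n : ℝ) ^ 2 + (6 * n + 4) / (n : ℝ) ^ 5 + (18 * n + 24) / (n : ℝ) ^ 7 ≤
      G.resolventEnergy := by
  subst hcard
  set N : ℝ := (Fintype.card V : ℝ) with hN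
  have hA := G.isHermitian_adjMatrix ℝ
  have hpos : 0 < N := by
    have := hG.1.nonempty
    exact Nat.cast_pos.2 Fintype.card_pos
  have hpt : ∀ i, 1 / N + hA.eigenvalues i ^ 1 / N ^ 2 + hA.eigenvalues i ^ 2 / N ^ 3 +
      hA.eigenvalues i ^ 3 / N ^ 4 + hA.eigenvalues i ^ 4 / N ^ 5 + hA.eigenvalues i ^ 5 / N ^ 6 +
      (6 * hA.eigenvalues i ^ 4 - 9 * hA.eigenvalues i ^ 2) / N ^ 7 +
      hA.eigenvalues i ^ 7 / N ^ 8 ≤ 1 / (N - hA.eigenvalues i) := by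
    intro i
    set x := hA.eigenvalues i
    have hx : 0 < N - x := sub_pos.2 (G.eigenvalues_adjMatrix_lt_card i)
    have hid : 1 / (N - x) = 1 / N + x ^ 1 / N ^ 2 + x ^ 2 / N ^ 3 + x ^ 3 / N ^ 4 + x ^ 4 / N ^ 5 +
        x ^ 5 / N ^ 6 + x ^ 6 / N ^ 7 + x ^ 7 / N ^ 8 + x ^ 8 / (N ^ 8 * (N - x)) := by
      field_simp
      ring
    have h8 : 0 ≤ x ^ 8 / (N ^ 8 * (N - x)) := by positivity
    -- This is x²(x² - 3)² ≥ 0; the 3 is the ratio 6n / 2n of the cycle's fourth and second moments.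
    have h6 : (6 * x ^ 4 - 9 * x ^ 2) / N ^ 7 ≤ x ^ 6 / N ^ 7 := by
      gcongr
      nlinarith [sq_nonneg (x * (x ^ 2 - 3))]
    linarith
  have hsum := sum_le_sum fun i (_ : i ∈ (univ : Finset V)) => hpt i
  simp only [sum_add_distrib, ← sum_div, sum_sub_distrib, ← mul_sum, hA.sum_eigenvalues_pow,
    G.trace_adjMatrix_sq, hG.2, sum_const, card_univ, nsmul_eq_mul, ← hN] at hsum
  rw [pow_one, trace_adjMatrix, zero_div, add_zero] at hsum
  have h3 : 0 ≤ (G.adjMatrix ℝ ^ 3).trace / N ^ 4 :=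
    div_nonneg (G.trace_adjMatrix_pow_nonneg 3) (by positivity)
  have h5 : 0 ≤ (G.adjMatrix ℝ ^ 5).trace / N ^ 6 :=
    div_nonneg (G.trace_adjMatrix_pow_nonneg 5) (by positivity)
  have h7 : 0 ≤ (G.adjMatrix ℝ ^ 7).trace / N ^ 8 :=
    div_nonneg (G.trace_adjMatrix_pow_nonneg 7) (by positivity)
  have hM : 6 * N + 4 ≤ (G.adjMatrix ℝ ^ 4).trace := by
    have h := G.le_trace_adjMatrix_pow_four
    rw [hG.2] at h
    linarith [hG.sum_degree_sq_ge G hdeg]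
  have h4 : (6 * N + 4) / N ^ 5 ≤ (G.adjMatrix ℝ ^ 4).trace / N ^ 5 := by gcongr
  have h6 : (18 * N + 24) / N ^ 7 ≤ (6 * (G.adjMatrix ℝ ^ 4).trace - 9 * (2 * N)) / N ^ 7 := by
    gcongr
    linarith
  have h0 : N * 1 / N = 1 := by field_simp
  have h2 : 2 * N / N ^ 3 = 2 / N ^ 2 := by field_simp
  have hER : G.resolventEnergy = ∑ i, 1 / (N - hA.eigenvalues i) := rfl
  rw [hER]
  linarith

end SimpleGraph

/-! ### Moments of the cycle and the upper bound -/

namespace Matrix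

variable {M : Type*} [AddGroup M] [Fintype M] [DecidableEq M]

theorem permMatrix_addRight_mul (a b : M) :
    (Equiv.addRight a).permMatrix ℝ * (Equiv.addRight b).permMatrix ℝ =
      (Equiv.addRight (a + b)).permMatrix ℝ := by
  rw [← permMatrix_mul]
  congr 1
  ext x
  simp [add_assoc]

theorem trace_permMatrix_addRight {a : M} (ha : a ≠ 0) :
    ((Equiv.addRight a).permMatrix ℝ).trace = 0 := by
  rw [trace_permutation]
  simp [Function.fixedPoints, Function.IsFixedPt, ha]

end Matrix

namespace SimpleGraph

/-- Powers thus expand binomially in cyclic shifts, and only the zero shift contributes to the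
trace. -/
theorem adjMatrix_cycleGraph (m : ℕ) :
    (cycleGraph (m + 3)).adjMatrix ℝ =
      (Equiv.addRight (1 : Fin (m + 3))).permMatrix ℝ + (Equiv.addRight (-1)).permMatrix ℝ := by
  ext i j
  have hne : i + 1 ≠ i + -1 := by
    intro h
    have := congrArg Fin.val (add_left_cancel h)
    simp at this
  have hiff : (cycleGraph (m + 3)).Adj i j ↔ i + 1 = j ∨ i + -1 = j := by
    rw [cycleGraph_adj]
    constructor
    · rintro (h | h)
      · right; rw [← h]; abel
      · left; rw [← h]; abel
    · rintro (h | h)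
      · right; rw [← h]; abel
      · left; rw [← h]; abel
  rw [adjMatrix_apply, Matrix.add_apply, Equiv.Perm.permMatrix, Equiv.Perm.permMatrix,
    PEquiv.toMatrix_apply, PEquiv.toMatrix_apply]
  simp only [Equiv.toPEquiv_apply, Option.mem_some_iff, Equiv.coe_addRight, hiff]
  by_cases h1 : i + 1 = j <;> by_cases h2 : i + -1 = j <;> simp_all

open scoped Fin.CommRing in
theorem trace_adjMatrix_cycleGraph_pow {n : ℕ} (hn : 5 ≤ n) :
    ((cycleGraph n).adjMatrix ℝ ^ 3).trace = 0 ∧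
      ((cycleGraph n).adjMatrix ℝ ^ 4).trace = 6 * n := by
  obtain ⟨m, rfl⟩ : ∃ m, n = m + 5 := ⟨n - 5, by omega⟩
  -- Here n ≥ 5 matters: shifts by up to 4 do not wrap around.
  have hval : ∀ k : ℕ, k ≠ 0 → k ≤ 4 → ((k : ℕ) : Fin (m + 5)) ≠ 0 := fun k h0 h4 h => by
    have := congrArg Fin.val h
    rw [Fin.val_natCast, Nat.mod_eq_of_lt (by omega)] at this
    exact h0 this
  have htr : ∀ k : ℕ, k ≠ 0 → k ≤ 4 →
      ((Equiv.addRight (k : Fin (m + 5))).permMatrix ℝ).trace = 0 ∧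
      ((Equiv.addRight (-k : Fin (m + 5))).permMatrix ℝ).trace = 0 := fun k h0 h4 =>
    ⟨trace_permMatrix_addRight (hval k h0 h4),
      trace_permMatrix_addRight (neg_ne_zero.2 (hval k h0 h4))⟩
  have hone : (Equiv.addRight (0 : Fin (m + 5))).permMatrix ℝ = 1 := by
    rw [Equiv.addRight_zero]; exact permMatrix_one
  set T : Fin (m + 5) → Matrix (Fin (m + 5)) (Fin (m + 5)) ℝ :=
    fun a => (Equiv.addRight a).permMatrix ℝ with hT
  have hmul : ∀ a b, T a * T b = T (a + b) := permMatrix_addRight_mul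
  have hA : (cycleGraph (m + 5)).adjMatrix ℝ = T 1 + T (-1) := adjMatrix_cycleGraph (m + 2)
  have h2 : (cycleGraph (m + 5)).adjMatrix ℝ ^ 2 = T 2 + T (-2) + 2 • T 0 := by
    rw [hA, pow_two, add_mul, mul_add, mul_add, hmul, hmul, hmul, hmul, add_neg_cancel,
      neg_add_cancel, one_add_one_eq_two, ← neg_add, one_add_one_eq_two, two_nsmul]
    abel
  have h3 : (cycleGraph (m + 5)).adjMatrix ℝ ^ 3 = T 3 + T (-3) + 3 • (T 1 + T (-1)) := by
    rw [pow_succ, h2, hA]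
    simp only [add_mul, mul_add, hmul, smul_mul_assoc, smul_add]
    rw [show (2 + 1 : Fin (m + 5)) = 3 by norm_num, show (2 + -1 : Fin (m + 5)) = 1 by ring,
      show (-2 + 1 : Fin (m + 5)) = -1 by ring, show (-2 + -1 : Fin (m + 5)) = -3 by ring,
      zero_add, zero_add]
    abel
  have h4 : (cycleGraph (m + 5)).adjMatrix ℝ ^ 4 = T 4 + T (-4) + 4 • (T 2 + T (-2)) + 6 • T 0 := by
    rw [pow_mul _ 2 2, h2, pow_two]
    simp only [add_mul, mul_add, hmul, smul_mul_assoc, mul_smul_comm, smul_add]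
    rw [show (2 + 2 : Fin (m + 5)) = 4 by norm_num, show (2 + -2 : Fin (m + 5)) = 0 by ring,
      show (-2 + 2 : Fin (m + 5)) = 0 by ring, show (-2 + -2 : Fin (m + 5)) = -4 by ring]
    simp only [zero_add, add_zero]
    abel
  have t1 := htr 1 (by norm_num) (by norm_num)
  have t2 := htr 2 (by norm_num) (by norm_num)
  have t3 := htr 3 (by norm_num) (by norm_num)
  have t4 := htr 4 (by norm_num) (by norm_num)
  push_cast at t1 t2 t3 t4
  constructor
  · rw [h3]
    simp only [trace_add, trace_smul, hT, t1, t3]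
    simp
  · rw [h4]
    simp only [trace_add, trace_smul, hT, t2, t4, hone, trace_one]
    simp
    ring

theorem cycleGraph_isUnicyclic {n : ℕ} (hn : 3 ≤ n) : (cycleGraph n).IsUnicyclic := by
  obtain ⟨m, rfl⟩ : ∃ m, n = m + 3 := ⟨n - 3, by omega⟩
  refine ⟨cycleGraph_connected, ?_⟩
  have h := (cycleGraph (m + 3)).sum_degrees_eq_twice_card_edges
  simp only [cycleGraph_degree_three_le, sum_const, card_univ, smul_eq_mul] at h
  convert (by omega : #(cycleGraph (m + 3)).edgeFinset = Fintype.card (Fin (m + 3)))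

/-- The bound comes from `x ^ 5 - 5 * x ^ 3 + 5 * x - 2 = (x - 2) * (x ^ 2 + x - 1) ^ 2`, which is
nonpositive on the spectrum of the cycle. -/
theorem resolventEnergy_cycleGraph_le {n : ℕ} (hn : 5 ≤ n) :
    (cycleGraph n).resolventEnergy ≤
      ((n : ℝ) ^ 5 - 3 * n ^ 3 + n) / ((n : ℝ) ^ 5 - 5 * n ^ 3 + 5 * n - 2) := by
  have hA := (cycleGraph n).isHermitian_adjMatrix ℝ
  have hN : (5 : ℝ) ≤ n := by exact_mod_cast hn
  have hF : 0 < (n : ℝ) ^ 5 - 5 * n ^ 3 + 5 * n - 2 := by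
    have : (n : ℝ) ^ 5 - 5 * n ^ 3 + 5 * n - 2 = (n - 2) * ((n : ℝ) ^ 2 + n - 1) ^ 2 := by ring
    rw [this]
    have h1 : (0 : ℝ) < n - 2 := by linarith
    have h2 : (0 : ℝ) < (n : ℝ) ^ 2 + n - 1 := by nlinarith
    positivity
  have hle : ∀ i, hA.eigenvalues i ≤ 2 := by
    have := (cycleGraph n).eigenvalues_adjMatrix_le (d := 2) (fun v => by
      obtain ⟨m, rfl⟩ : ∃ m, n = m + 3 := ⟨n - 3, by omega⟩
      exact cycleGraph_degree_three_le.le)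
    exact_mod_cast this
  -- With F the quintic, the numerator is (F(n) - F(x)) / (n - x), and F(x) ≤ 0 for x ≤ 2.
  have hpt : ∀ i, 1 / ((n : ℝ) - hA.eigenvalues i) ≤
      ((n : ℝ) ^ 4 - 5 * n ^ 2 + 5 + ((n : ℝ) ^ 3 - 5 * n) * hA.eigenvalues i ^ 1 +
        ((n : ℝ) ^ 2 - 5) * hA.eigenvalues i ^ 2 + n * hA.eigenvalues i ^ 3 +
        hA.eigenvalues i ^ 4) / ((n : ℝ) ^ 5 - 5 * n ^ 3 + 5 * n - 2) := by
    intro i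
    have hi := hle i
    set x := hA.eigenvalues i
    have hx : 0 < (n : ℝ) - x := by linarith
    rw [div_le_div_iff₀ hx hF]
    nlinarith [mul_nonneg (sub_nonneg.2 hi) (sq_nonneg (x ^ 2 + x - 1))]
  have hsum := sum_le_sum fun i (_ : i ∈ (univ : Finset (Fin n))) => hpt i
  obtain ⟨h3, h4⟩ := trace_adjMatrix_cycleGraph_pow hn
  simp only [← sum_div, sum_add_distrib, ← mul_sum, hA.sum_eigenvalues_pow, h3, h4,
    trace_adjMatrix_sq, (cycleGraph_isUnicyclic (by omega : 3 ≤ n)).2, sum_const, card_univ,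
    Fintype.card_fin, nsmul_eq_mul] at hsum
  rw [pow_one, trace_adjMatrix] at hsum
  have hER : (cycleGraph n).resolventEnergy = ∑ i, 1 / ((n : ℝ) - hA.eigenvalues i) := by
    simp only [resolventEnergy, Fintype.card_fin]
  rw [hER]
  refine hsum.trans_eq ?_
  congr 1
  ring

end SimpleGraph

theorem resolvent_bounds_lt {x : ℝ} (hx : 5 ≤ x) :
    (x ^ 5 - 3 * x ^ 3 + x) / (x ^ 5 - 5 * x ^ 3 + 5 * x - 2) <
      1 + 2 / x ^ 2 + (6 * x + 4) / x ^ 5 + (18 * x + 24) / x ^ 7 := by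
  -- After the shift to t ≥ 0, the polynomials to be shown positive expand with positive
  -- coefficients only.
  obtain ⟨t, ht, rfl⟩ : ∃ t : ℝ, 0 ≤ t ∧ x = t + 5 := ⟨x - 5, by linarith, by ring⟩
  have hF : 0 < (t + 5) ^ 5 - 5 * (t + 5) ^ 3 + 5 * (t + 5) - 2 := by
    ring_nf
    positivity
  have hid : 1 + 2 / (t + 5) ^ 2 + (6 * (t + 5) + 4) / (t + 5) ^ 5 +
      (18 * (t + 5) + 24) / (t + 5) ^ 7 =
      ((t + 5) ^ 7 + 2 * (t + 5) ^ 5 + (6 * (t + 5) + 4) * (t + 5) ^ 2 + (18 * (t + 5) + 24)) /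
        (t + 5) ^ 7 := by
    field_simp
  rw [hid, div_lt_div_iff₀ hF (by positivity), ← sub_pos]
  ring_nf
  positivity

theorem mainTheorem2 (n : ℕ) (hn : 5 ≤ n) :
    (SimpleGraph.cycleGraph n).IsUnicyclic ∧
    ∀ (V : Type*) [Fintype V] [DecidableEq V] (G : SimpleGraph V) [DecidableRel G.Adj],
      Fintype.card V = n → G.IsUnicyclic →
      ¬ Nonempty (G ≃g SimpleGraph.cycleGraph n) →
      G.resolventEnergy > (SimpleGraph.cycleGraph n).resolventEnergy := by
  refine ⟨SimpleGraph.cycleGraph_isUnicyclic (by omega), fun V _ _ G _ hcard hG hiso => ?_⟩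
  have hdeg : ∃ v, G.degree v ≠ 2 := by
    by_contra! h
    exact hiso (hG.1.nonempty_iso_cycleGraph G (by omega) hcard h)
  have hN : (5 : ℝ) ≤ n := by exact_mod_cast hn
  exact ((SimpleGraph.resolventEnergy_cycleGraph_le hn).trans_lt (resolvent_bounds_lt hN)).trans_le
    (hG.resolventEnergy_ge G hdeg hcard)
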